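/- **Proposition 3.3.** Let $\Lambda$ be an Artin algebra (an algebra over a commutative Artinian ring $R$, finitely generated as an $R$-module), let $\operatorname{mod}\Lambda$ be the category of finitely generated left $\Lambda$-modules, and suppose that $\operatorname{gl.dim}\Lambda=n$ with $n\ge 2$. Suppose that $\Lambda$ admits a maximal $(n-1)$-orthogonal subcategory of $\operatorname{mod}\Lambda$, that is, a full subcategory $\mathscr C\subseteq\operatorname{mod}\Lambda$ which is functorially finite in $\operatorname{mod}\Lambda$ (every $X\in\operatorname{mod}\Lambda$ has a left and a right $\mathscr C$-approximation) and satisfies $$\mathscr C=\{X\in\operatorname{mod}\Lambda \mid \operatorname{Ext}^i_\Lambda(X,C)=0\ \text{for all } C\in\mathscr C,\ 1\le i\le n-1\}$$ $$\phantom{\mathscr C}=\{X\in\operatorname{mod}\Lambda \mid \operatorname{Ext}^i_\Lambda(C,X)=0\ \text{for all } C\in\mathscr C,\ 1\le i\le n-1\}.$$ Let $0\to\Lambda\to I^0(\Lambda)\to I^1(\Lambda)\to\cdots$ and $0\to\Lambda^{op}\to I^0(\Lambda^{op})\to I^1(\Lambda^{op})\to\cdots$ be minimal injective resolutions of the regular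 left modules over $\Lambda$ and over the opposite algebra $\Lambda^{op}$. Then the following statements are equivalent. 1. $\Lambda$ is an $(n-1)$-Auslander algebra, i.e. $\operatorname{gl.dim}\Lambda\le n$ and $I^0(\Lambda),I^1(\Lambda),\dots,I^{n-1}(\Lambda)$ are projective. 2. $\operatorname{pd}_\Lambda\bigoplus_{i=1}^{n-1}I^i(\Lambda)\le n-1$. 3. $\operatorname{pd}_{\Lambda^{op}}\bigoplus_{i=1}^{n-1}I^i(\Lambda^{op})\le n-1$. -/

import Mathlib

open CategoryTheory

universe u

namespace HigherAuslander

noncomputable section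

/-! ### Injective envelopes and minimal injective resolutions -/

/-- `f : M ⟶ E` is an injective envelope: `E` is injective, `f` is a monomorphism and its image is
essential, i.e. it meets every nonzero submodule of `E` nontrivially. -/
structure IsInjectiveEnvelope {Λ : Type u} [Ring Λ] {M E : ModuleCat.{u} Λ} (f : M ⟶ E) :
    Prop where
  injective : Injective E
  mono : Mono f
  essential : ∀ N : Submodule Λ E, N ⊓ LinearMap.range f.hom = ⊥ → N = ⊥

/-- Inside an injective module every submodule is contained, as an essential submodule,
in a submodule that is injective. -/
theorem exists_injective_essential_extension {Λ : Type u} [Ring Λ] {E : Type u} [AddCommGroup E]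
    [Module Λ E] [hE : Module.Injective Λ E] (A : Submodule Λ E) :
    ∃ N : Submodule Λ E, A ≤ N ∧ (∀ x ∈ N, x ≠ 0 → ∃ r : Λ, r • x ≠ 0 ∧ r • x ∈ A) ∧
      Module.Injective Λ N := by
  -- a maximal essential extension `N` of `A` inside `E`
  obtain ⟨N, hAN, hN⟩ := zorn_le_nonempty₀
    {N : Submodule Λ E | A ≤ N ∧ ∀ x ∈ N, x ≠ 0 → ∃ r : Λ, r • x ≠ 0 ∧ r • x ∈ A}
    (fun c hc hchain y hy => ⟨sSup c, ⟨(hc hy).1.trans (le_sSup hy), fun x hx hx0 => by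
      obtain ⟨N, hNc, hxN⟩ := (Submodule.mem_sSup_of_directed ⟨y, hy⟩ hchain.directedOn).1 hx
      exact (hc hNc).2 x hxN hx0⟩, fun z hz => le_sSup hz⟩)
    A ⟨le_rfl, fun x hx hx0 => ⟨1, by simpa using hx0, by simpa using hx⟩⟩
  -- a maximal submodule `P` with `P ∩ N = 0`
  obtain ⟨P, -, hP⟩ := zorn_le_nonempty₀
    {P : Submodule Λ E | ∀ x ∈ P, x ∈ N → x = 0}
    (fun c hc hchain y hy => ⟨sSup c, fun x hx hxN => by
      obtain ⟨Q, hQc, hxQ⟩ := (Submodule.mem_sSup_of_directed ⟨y, hy⟩ hchain.directedOn).1 hx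
      exact hc hQc x hxQ hxN, fun z hz => le_sSup hz⟩)
    ⊥ (fun x hx _ => by simpa using hx)
  let j : N →ₗ[Λ] E ⧸ P := P.mkQ ∘ₗ N.subtype
  have hj : Function.Injective j := by
    rw [injective_iff_map_eq_zero]
    intro x hx
    exact Subtype.ext (hP.1 x ((Submodule.Quotient.mk_eq_zero P).1 hx) x.2)
  have hess : ∀ y : E ⧸ P, y ≠ 0 → ∃ (r : Λ) (n : N), n ≠ 0 ∧ r • y = j n := by
    intro y hy
    obtain ⟨e, rfl⟩ := P.mkQ_surjective y
    have he : e ∉ P := fun h => hy ((Submodule.Quotient.mk_eq_zero P).2 h)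
    by_contra! hcon
    apply he
    have : (P ⊔ Submodule.span Λ {e}) ≤ P := hP.2 (fun x hx hxN => by
      obtain ⟨p, hp, z, hz, rfl⟩ := Submodule.mem_sup.1 hx
      obtain ⟨r, rfl⟩ := Submodule.mem_span_singleton.1 hz
      by_contra hne
      refine hcon r ⟨_, hxN⟩ (fun h => hne (congrArg Subtype.val h)) ?_
      have : P.mkQ p = 0 := (Submodule.Quotient.mk_eq_zero P).2 hp
      simp only [j, LinearMap.comp_apply, Submodule.subtype_apply, map_add, map_smul, this,
        zero_add]) le_sup_left
    exact this (Submodule.mem_sup_right (Submodule.mem_span_singleton_self e))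
  obtain ⟨g, hg⟩ := hE.out j hj N.subtype
  have hgN : LinearMap.range g ≤ N := by
    refine hN.2 ⟨hAN.trans ?_, ?_⟩ ?_
    · intro x hx; exact ⟨j ⟨x, hx⟩, hg ⟨x, hx⟩⟩
    · rintro _ ⟨y, rfl⟩ hy
      obtain ⟨r, n, hn, hrn⟩ := hess y (fun h => hy (by simp [h]))
      have h1 : r • g y = n := by rw [← map_smul, hrn, hg]; rfl
      obtain ⟨s, hs0, hsA⟩ := hN.1.2 n n.2 (fun h => hn (Subtype.ext h))
      exact ⟨s * r, by rwa [mul_smul, h1], by rwa [mul_smul, h1]⟩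
    · intro x hx; exact ⟨j ⟨x, hx⟩, hg ⟨x, hx⟩⟩
  refine ⟨N, hAN, hN.1.2, ⟨fun X Y _ _ _ _ f hf k => ?_⟩⟩
  obtain ⟨h, hh⟩ := hE.out f hf (N.subtype ∘ₗ k)
  refine ⟨LinearMap.codRestrict N (g ∘ₗ P.mkQ ∘ₗ h) (fun y => hgN ⟨_, rfl⟩), fun x => ?_⟩
  apply Subtype.ext
  have := hg (k x)
  simp only [LinearMap.codRestrict_apply, LinearMap.comp_apply, hh]
  exact this

/-- Every module has an injective envelope. -/
theorem exists_isInjectiveEnvelope {Λ : Type u} [Ring Λ] (M : ModuleCat.{u} Λ) :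
    ∃ (E : ModuleCat.{u} Λ) (f : M ⟶ E), IsInjectiveEnvelope f := by
  let U : ModuleCat.{u} Λ := Injective.under M
  have hE : Module.Injective Λ U :=
    (Module.injective_iff_injective_object Λ U).2 (Injective.injective_under M)
  have hι : Function.Injective (Injective.ι M).hom :=
    (ModuleCat.mono_iff_injective _).1 inferInstance
  obtain ⟨N, hAN, hess, hN⟩ :=
    exists_injective_essential_extension (E := U) (LinearMap.range (Injective.ι M).hom)
  have hmem : ∀ m, (Injective.ι M).hom m ∈ N := fun m => hAN ⟨m, rfl⟩
  refine ⟨ModuleCat.of Λ N, ModuleCat.ofHom (LinearMap.codRestrict N (Injective.ι M).hom hmem),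
    (Module.injective_iff_injective_object Λ _).1 hN, ?_, ?_⟩
  · rw [ModuleCat.mono_iff_injective]
    intro x y hxy
    exact hι (congrArg Subtype.val hxy)
  · intro K hK
    rw [eq_bot_iff]
    intro x hx
    by_contra hx0
    obtain ⟨r, hr0, m, hm⟩ := hess x.1 x.2 (fun h => hx0 (Subtype.ext h))
    have hmemK : r • x ∈ K ⊓ LinearMap.range (ModuleCat.ofHom
        (LinearMap.codRestrict N (Injective.ι M).hom hmem)).hom :=
      ⟨K.smul_mem r hx, m, Subtype.ext hm⟩
    rw [hK] at hmemK
    exact hr0 (congrArg Subtype.val hmemK)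

section

variable {Λ : Type u} [Ring Λ]

/-- The injective envelope `I(M)` of a module `M`. -/
def envelope (M : ModuleCat.{u} Λ) : ModuleCat.{u} Λ :=
  (exists_isInjectiveEnvelope M).choose

/-- The inclusion of a module into its injective envelope. -/
def envelopeι (M : ModuleCat.{u} Λ) : M ⟶ envelope M :=
  (exists_isInjectiveEnvelope M).choose_spec.choose

theorem isInjectiveEnvelope_envelopeι (M : ModuleCat.{u} Λ) :
    IsInjectiveEnvelope (envelopeι M) :=
  (exists_isInjectiveEnvelope M).choose_spec.choose_spec

/-- The `i`-th cosyzygy of `M`: the `0`-th one is `M`, and the next one is the cokernel of the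
inclusion of the current one into its injective envelope. -/
def cosyzygy (M : ModuleCat.{u} Λ) : ℕ → ModuleCat.{u} Λ
  | 0 => M
  | i + 1 => ModuleCat.of Λ
      (envelope (cosyzygy M i) ⧸ LinearMap.range (envelopeι (cosyzygy M i)).hom)

/-- The `i`-th term `Iⁱ(M)` of the minimal injective resolution
`0 → M → I⁰(M) → I¹(M) → ⋯` of `M`. -/
def minInj (M : ModuleCat.{u} Λ) (i : ℕ) : ModuleCat.{u} Λ :=
  envelope (cosyzygy M i)

end

/-! ### Global dimension and higher Auslander algebras -/

/-- The (left) global dimension of a ring: the supremum of the projective dimensions of its left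
modules. -/
def glDim (Λ : Type u) [Ring Λ] : WithBot ℕ∞ :=
  ⨆ M : ModuleCat.{u} Λ, projectiveDimension M

/-- The regular left module `Λ`. -/
abbrev regular (Λ : Type u) [Ring Λ] : ModuleCat.{u} Λ := ModuleCat.of Λ Λ

/-- `Λ` is an `m`-Auslander algebra (`m` a positive integer, `Λ` an Artin algebra):
`gl.dim Λ ≤ m + 1` and `I⁰(Λ), …, Iᵐ(Λ)` are projective. -/
structure IsAuslanderAlgebra (m : ℕ) (Λ : Type u) [Ring Λ] : Prop where
  glDim_le : glDim Λ ≤ ((m + 1 : ℕ) : WithBot ℕ∞)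
  projective : ∀ i ≤ m, Projective (minInj (regular Λ) i)

/-- `I¹(Λ) ⊕ ⋯ ⊕ Iᵐ(Λ)`. -/
def sumMinInj (m : ℕ) (Λ : Type u) [Ring Λ] : ModuleCat.{u} Λ :=
  ModuleCat.of Λ (DirectSum (Finset.Icc 1 m) fun i => minInj (regular Λ) i)

/-! ### Maximal orthogonal subcategories

Full subcategories of `mod Λ` are given by the property of belonging to them. -/

section

variable {Λ : Type u} [Ring Λ]

/-- Every object of `𝒟` has a left `𝒞`-approximation. -/
def CovariantlyFinite (𝒞 𝒟 : ObjectProperty (ModuleCat.{u} Λ)) : Prop :=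
  ∀ D, 𝒟 D → ∃ (C : ModuleCat.{u} Λ) (f : D ⟶ C), 𝒞 C ∧
    ∀ C', 𝒞 C' → ∀ g : D ⟶ C', ∃ h : C ⟶ C', f ≫ h = g

/-- Every object of `𝒟` has a right `𝒞`-approximation. -/
def ContravariantlyFinite (𝒞 𝒟 : ObjectProperty (ModuleCat.{u} Λ)) : Prop :=
  ∀ D, 𝒟 D → ∃ (C : ModuleCat.{u} Λ) (f : C ⟶ D), 𝒞 C ∧
    ∀ C', 𝒞 C' → ∀ g : C' ⟶ D, ∃ h : C' ⟶ C, h ≫ f = g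

/-- The finitely generated modules `X` with `Extⁱ(X, C) = 0` for all `C` in `𝒞`, `1 ≤ i ≤ m`. -/
def leftPerp (m : ℕ) (𝒞 : ObjectProperty (ModuleCat.{u} Λ)) : ObjectProperty (ModuleCat.{u} Λ) :=
  fun X => Module.Finite Λ X ∧
    ∀ C, 𝒞 C → ∀ i : ℕ, 1 ≤ i → i ≤ m → Subsingleton (Abelian.Ext X C i)

/-- The finitely generated modules `X` with `Extⁱ(C, X) = 0` for all `C` in `𝒞`, `1 ≤ i ≤ m`. -/
def rightPerp (m : ℕ) (𝒞 : ObjectProperty (ModuleCat.{u} Λ)) : ObjectProperty (ModuleCat.{u} Λ) :=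
  fun X => Module.Finite Λ X ∧
    ∀ C, 𝒞 C → ∀ i : ℕ, 1 ≤ i → i ≤ m → Subsingleton (Abelian.Ext C X i)

/-- `𝒞` is a maximal `m`-orthogonal subcategory of the full subcategory `𝒟` of `mod Λ`. -/
structure IsMaximalOrthogonal (m : ℕ) (𝒞 𝒟 : ObjectProperty (ModuleCat.{u} Λ)) : Prop where
  le : 𝒞 ≤ 𝒟
  covariantlyFinite : CovariantlyFinite 𝒞 𝒟
  contravariantlyFinite : ContravariantlyFinite 𝒞 𝒟
  eq_left : 𝒞 = leftPerp m 𝒞 ⊓ 𝒟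
  eq_right : 𝒞 = rightPerp m 𝒞 ⊓ 𝒟

end

end

end HigherAuslander

/-! A maximal (n-1)-orthogonal subcategory contains every finitely generated projective and every
finitely generated injective. Hence Extⁱ(J, P) = 0 for such J injective, P projective and 1 ≤ i ≤
n-1, and this vanishing is all that is taken from the subcategory. By dimension shifting, a finitely
generated injective of projective dimension at most n-1 is projective (`projective_of_ext_eq_zero`),
and a finitely generated projective of injective dimension at most n-1 is injective
(`injective_of_ext_eq_zero`).

2 ⇒ 1: the terms I¹, …, Iⁿ⁻¹ become projective at once. Descending from the n-th cosyzygy, whose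
projective dimension is at most n, through these projectives shows that the first cosyzygy has
projective dimension at most 1. So I⁰ has projective dimension at most 1 ≤ n-1 and is projective
too.

3 ⇒ 1: dualizing the resolution of the opposite algebra gives finitely generated projective
Λ-modules. The dual argument makes them injective, so the first n terms for Λᵒᵖ are projective. One
returns to Λ by left-right symmetry of the dominant dimension (`projective_minInj_dual`), which also
gives 1 ⇒ 3.

For this symmetry, a coresolution of A by projective-injectives is turned into a resolution of the
dual of the opposite algebra (`hasProjInjResolution_of_hasInjectiveDimensionLT`). Its dual
coresolves the opposite algebra, and the minimal resolution is a direct summand of that. The duality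
itself is Hom into the module coinduced from a Matlis module of the base ring. -/

namespace HigherAuslander

/-! ### Matlis duality over a commutative Artinian ring -/

/-- An injective cogenerator of the modules over a commutative ring `R`, such that the modules of
homomorphisms from simple modules into it have length at most one. -/
structure IsMatlisModule (R : Type u) [CommRing R] (E : Type u) [AddCommGroup E] [Module R E] :
    Prop where
  injective : Module.Injective R E
  cogenerator : ∀ (M : Type u) [AddCommGroup M] [Module R M] (m : M), m ≠ 0 →
    ∃ f : M →ₗ[R] E, f m ≠ 0
  length_simple : ∀ (S : Type u) [AddCommGroup S] [Module R S] [IsSimpleModule R S],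
    Module.length R (S →ₗ[R] E) ≤ 1

/-- A lift s of x lies outside m, since otherwise x² = 0 in a reduced ring. So s is invertible
modulo m and x generates everything killed by m. -/
theorem exists_eq_smul_of_isReduced {R K : Type*} [CommRing R] [CommRing K] [Algebra R K]
    [IsReduced K] (hK : Function.Surjective (algebraMap R K)) (m : Ideal R) [hm : m.IsMaximal]
    {x y : K} (hx0 : x ≠ 0) (hx : ∀ a ∈ m, a • x = 0) (hy : ∀ a ∈ m, a • y = 0) :
    ∃ r : R, y = r • x := by
  obtain ⟨s, rfl⟩ := hK x
  have hs : s ∉ m := by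
    intro h
    have h1 := hx s h
    rw [Algebra.smul_def, ← sq] at h1
    exact hx0 (pow_eq_zero_iff two_ne_zero |>.1 h1)
  obtain ⟨t, c, hc, htc⟩ := hm.exists_inv hs
  obtain ⟨z, rfl⟩ := hK y
  refine ⟨t * z, ?_⟩
  have h1 := hy c hc
  rw [Algebra.smul_def, ← map_mul] at h1 ⊢
  rw [show t * z * s = z - c * z by linear_combination z * htc, map_sub, h1, sub_zero]

theorem length_le_one_of_forall_smul {R M : Type*} [Ring R] [AddCommGroup M] [Module R M]
    (h : ∀ x y : M, x ≠ 0 → ∃ r : R, y = r • x) : Module.length R M ≤ 1 := by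
  by_cases hM : Subsingleton M
  · simp
  · have : Nontrivial M := not_subsingleton_iff_nontrivial.1 hM
    have : IsSimpleModule R M := by
      rw [isSimpleModule_iff_toSpanSingleton_surjective]
      exact ⟨inferInstance, fun x hx y => (h x y hx).imp fun r hr => hr.symm⟩
    simp

/-- The injective envelope of R modulo its nilradical works: this quotient is semisimple, so it
contains a copy of each simple module, and each simple type occurs only once because the quotient
ring is reduced. -/
theorem exists_isMatlisModule (R : Type u) [CommRing R] [IsArtinianRing R] :
    ∃ (E : Type u) (_ : AddCommGroup E) (_ : Module R E), IsMatlisModule R E := by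
  let K := R ⧸ nilradical R
  have hKred : IsReduced K := (Ideal.isRadical_iff_quotient_reduced _).1 (Ideal.radical_isRadical _)
  obtain ⟨E, ι, hι⟩ := exists_isInjectiveEnvelope (ModuleCat.of R K)
  have hE : Module.Injective R E := (Module.injective_iff_injective_object R E).2 hι.injective
  have hιi : Function.Injective ι.hom := (ModuleCat.mono_iff_injective _).1 hι.mono
  have hsurj : Function.Surjective (algebraMap R K) := Ideal.Quotient.mk_surjective
  have hKss : IsSemisimpleModule R K := by
    have : IsSemisimpleRing K := IsArtinianRing.isSemisimpleRing_of_isReduced K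
    let l : K →ₛₗ[algebraMap R K] K :=
      { AddMonoidHom.id K with map_smul' := fun r x => Algebra.smul_def r x }
    have _i : RingHomSurjective (algebraMap R K) := ⟨hsurj⟩
    exact (l.isSemisimpleModule_iff_of_bijective Function.bijective_id).2 this
  have hmax : ∀ m : Ideal R, m.IsMaximal → ∃ f : (R ⧸ m) →ₗ[R] K, Function.Injective f := by
    intro m hm
    have hle : nilradical R ≤ m := nilradical_le_prime m
    let p : K →ₗ[R] R ⧸ m := Submodule.mapQ _ _ LinearMap.id hle
    have hp : Function.Surjective p := by
      intro x
      obtain ⟨x, rfl⟩ := Ideal.Quotient.mk_surjective x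
      exact ⟨Ideal.Quotient.mk _ x, rfl⟩
    obtain ⟨f, hf⟩ := IsSemisimpleModule.lifting_property p hp LinearMap.id
    exact ⟨f, fun x y h => by simpa [← LinearMap.comp_apply, hf] using congrArg p h⟩
  refine ⟨E, inferInstance, inferInstance, hE, ?_, ?_⟩
  · intro M _ _ x hx
    obtain ⟨m, hm, hle⟩ := Ideal.exists_le_maximal (LinearMap.ker (LinearMap.toSpanSingleton R M x))
      (by intro h; exact hx (by simpa using (h ▸ Submodule.mem_top : (1 : R) ∈ LinearMap.ker (LinearMap.toSpanSingleton R M x))))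
    obtain ⟨f, hf⟩ := hmax m hm
    let g : R ⧸ LinearMap.ker (LinearMap.toSpanSingleton R M x) →ₗ[R] E :=
      ι.hom ∘ₗ f ∘ₗ Submodule.mapQ _ _ LinearMap.id hle
    let j : R ⧸ LinearMap.ker (LinearMap.toSpanSingleton R M x) →ₗ[R] M :=
      Submodule.liftQ _ (LinearMap.toSpanSingleton R M x) le_rfl
    have hj : Function.Injective j := by
      rw [← LinearMap.ker_eq_bot]; exact Submodule.ker_liftQ_eq_bot _ _ _ le_rfl
    obtain ⟨h, hh⟩ := hE.out j hj g
    refine ⟨h, fun h0 => ?_⟩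
    have h1 := hh (Submodule.Quotient.mk 1)
    have h2 : j (Submodule.Quotient.mk 1) = x := one_smul R x
    rw [h2, h0] at h1
    have h3 : ι.hom (f (Submodule.Quotient.mk 1)) = 0 := h1.symm
    rw [map_eq_zero_iff _ hιi, map_eq_zero_iff _ hf, Submodule.Quotient.mk_eq_zero] at h3
    exact hm.ne_top (m.eq_top_iff_one.2 h3)
  · intro S _ _ _
    refine length_le_one_of_forall_smul fun f g hf => ?_
    obtain ⟨s, hs⟩ : ∃ s, f s ≠ 0 := by
      by_contra! h; exact hf (LinearMap.ext h)
    have hs0 : s ≠ 0 := by rintro rfl; simp at hs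
    -- A nonzero map from a simple module is injective, and its image meets the essential submodule
    -- K. Simplicity moves a nonzero r • s back to s, so f s itself lies in K.
    have key : ∀ f : S →ₗ[R] E, ∃ x : K, ι.hom x = f s := by
      intro f
      by_cases hfs : f s = 0
      · exact ⟨0, by rw [hfs, map_zero]⟩
      have hinj : Function.Injective f := by
        rcases f.injective_or_eq_zero with h | h
        · exact h
        · simp [h] at hfs
      have : Submodule.span R {f s} ⊓ LinearMap.range ι.hom ≠ ⊥ := by
        intro h
        exact hfs (Submodule.span_singleton_eq_bot.1 (hι.essential _ h))
      obtain ⟨y, ⟨hy1, z, hz⟩, hy0⟩ := Submodule.exists_mem_ne_zero_of_ne_bot this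
      obtain ⟨r, rfl⟩ := Submodule.mem_span_singleton.1 hy1
      have hrs : r • s ≠ 0 := fun h => hy0 (by rw [← map_smul, h, map_zero])
      obtain ⟨t, ht⟩ := (isSimpleModule_iff_toSpanSingleton_surjective.1 ‹IsSimpleModule R S›).2 _ hrs s
      refine ⟨t • z, ?_⟩
      rw [LinearMap.toSpanSingleton_apply] at ht
      rw [map_smul, hz, ← map_smul, ← map_smul, ht]
    have hann : ∀ f : S →ₗ[R] E, ∀ x : K, ι.hom x = f s →
        ∀ a ∈ LinearMap.ker (LinearMap.toSpanSingleton R S s), a • x = 0 := by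
      intro f x hx a ha
      apply hιi
      rw [map_zero]
      erw [map_smul]
      rw [hx, ← map_smul, show a • s = 0 from ha, map_zero]
    obtain ⟨x, hx⟩ := key f
    obtain ⟨y, hy⟩ := key g
    have := IsSimpleModule.ker_toSpanSingleton_isMaximal R hs0
    obtain ⟨r, hr⟩ := exists_eq_smul_of_isReduced hsurj _
      (by rintro rfl; exact hs (by rw [← hx]; exact map_zero _)) (hann f x hx) (hann g y hy)
    refine ⟨r, LinearMap.ext fun s' => ?_⟩
    obtain ⟨t, rfl⟩ := (isSimpleModule_iff_toSpanSingleton_surjective.1 ‹IsSimpleModule R S›).2 _ hs0 s'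
    rw [LinearMap.toSpanSingleton_apply, map_smul, map_smul, LinearMap.smul_apply, ← hy, hr, ← hx]
    erw [map_smul]

/-- Hom into E is exact, so lengths add up along a composition series, each factor contributing at
most one. -/
theorem IsMatlisModule.length_hom_le {R : Type u} [CommRing R] {E : Type u} [AddCommGroup E]
    [Module R E] (hE : IsMatlisModule R E) {M : Type u} [AddCommGroup M] [Module R M]
    (hM : IsFiniteLength R M) : Module.length R (M →ₗ[R] E) ≤ Module.length R M := by
  induction hM with
  | of_subsingleton =>
    rw [Module.length_eq_zero_iff.2]
    · exact zero_le
    · exact ⟨fun f g => LinearMap.ext fun x => by rw [Subsingleton.elim x 0, map_zero, map_zero]⟩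
  | @of_simple_quotient M _ _ N _ hN ih =>
    have h1 : Module.length R (M →ₗ[R] E) =
        Module.length R ((M ⧸ N) →ₗ[R] E) + Module.length R (N →ₗ[R] E) := by
      refine Module.length_eq_add_of_exact (LinearMap.lcomp R E N.mkQ) (LinearMap.lcomp R E N.subtype)
        (fun f g h => ?_) ?_ ?_
      · exact LinearMap.cancel_right N.mkQ_surjective |>.1 h
      · intro g
        obtain ⟨h, hh⟩ := hE.injective.out N.subtype N.subtype_injective g
        exact ⟨h, LinearMap.ext hh⟩
      · intro f
        constructor
        · intro hf
          exact ⟨N.liftQ f (fun x hx => LinearMap.congr_fun hf (⟨x, hx⟩ : N)), rfl⟩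
        · rintro ⟨g, rfl⟩
          ext x
          have : N.mkQ x = 0 := (Submodule.Quotient.mk_eq_zero N).2 x.2
          simp only [LinearMap.lcomp_apply, Submodule.subtype_apply, this, map_zero,
            LinearMap.zero_apply]
    have h2 : Module.length R M = Module.length R N + Module.length R (M ⧸ N) :=
      Module.length_eq_add_of_exact N.subtype N.mkQ N.subtype_injective N.mkQ_surjective
        (LinearMap.exact_subtype_mkQ N)
    rw [h1, h2, Module.length_eq_one R (M ⧸ N), add_comm]
    exact add_le_add ih (hE.length_simple _)

/-! ### Duality for modules over an Artin algebra -/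

section

variable (A B W : Type u) [Ring A] [Ring B] [AddCommGroup W] [Module A W] [Module B W]
  [SMulCommClass A B W] [SMulCommClass B A W]

/-- The bimodule `W` makes `M ↦ Hom_A(M, W)` a faithful exact functor to `B`-modules which preserves
finitely generated modules, and finitely generated `A`-modules are reflexive. -/
structure IsHalfDuality : Prop where
  injective : Module.Injective A W
  cogenerator : ∀ (M : Type u) [AddCommGroup M] [Module A M] (m : M), m ≠ 0 →
    ∃ f : M →ₗ[A] W, f m ≠ 0
  finite : ∀ (M : Type u) [AddCommGroup M] [Module A M] [Module.Finite A M],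
    Module.Finite B (M →ₗ[A] W)
  reflexive : ∀ (M : Type u) [AddCommGroup M] [Module A M] [Module.Finite A M]
    (φ : (M →ₗ[A] W) →ₗ[B] W), ∃ m, ∀ f, φ f = f m

end

section

variable {R E : Type u} [CommRing R] [AddCommGroup E] [Module R E]

/-- `t : W → E` identifies the `A`-module `W` with the module coinduced from `E`. -/
structure IsTrace (A : Type u) {W : Type u} [Ring A] [Algebra R A] [AddCommGroup W] [Module A W]
    [Module R W] (t : W →ₗ[R] E) : Prop where
  ext : ∀ w w' : W, (∀ a : A, t (a • w) = t (a • w')) → w = w'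
  exists_eq : ∀ φ : A →ₗ[R] E, ∃ w, ∀ a : A, t (a • w) = φ a

variable {A W : Type u} [Ring A] [Algebra R A] [AddCommGroup W] [Module A W]
  [Module R W] [IsScalarTower R A W] {t : W →ₗ[R] E}

/-- The coinduction adjunction: f x is recovered from φ as the unique w with t (a • w) = φ (a • x)
for all a. -/
theorem IsTrace.bijective (ht : IsTrace A t) (M : Type u) [AddCommGroup M] [Module A M] [Module R M]
    [IsScalarTower R A M] :
    Function.Bijective (fun f : M →ₗ[A] W => t ∘ₗ f.restrictScalars R) := by
  constructor
  · intro f g h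
    ext x
    refine ht.ext _ _ fun a => ?_
    rw [← map_smul, ← map_smul]
    exact LinearMap.congr_fun h (a • x)
  · intro φ
    choose w hw using fun x : M => ht.exists_eq (φ ∘ₗ (LinearMap.toSpanSingleton A M x).restrictScalars R)
    replace hw : ∀ x a, t (a • w x) = φ (a • x) := hw
    refine ⟨⟨⟨w, fun x y => ht.ext _ _ fun a => ?_⟩, fun b x => ht.ext _ _ fun a => ?_⟩,
      LinearMap.ext fun x => ?_⟩
    · rw [smul_add, map_add, hw, hw, hw, smul_add, map_add]
    · simp only [RingHom.id_apply]
      rw [hw, ← mul_smul, ← mul_smul, hw]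
    · have := hw x 1
      rwa [one_smul, one_smul] at this

/-- The identification `Hom_A(M, W) ≃ Hom_R(M, E)` for a coinduced module `W`. -/
noncomputable def IsTrace.equiv (ht : IsTrace A t) (M : Type u) [AddCommGroup M] [Module A M]
    [Module R M] [IsScalarTower R A M] : (M →ₗ[A] W) ≃ₗ[R] (M →ₗ[R] E) :=
  LinearEquiv.ofBijective
    { toFun := fun f => t ∘ₗ f.restrictScalars R
      map_add' := fun f g => by ext; simp
      map_smul' := fun r f => by ext; simp } (ht.bijective M)

theorem IsTrace.injective (ht : IsTrace A t) (hE : Module.Injective R E) :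
    Module.Injective A W := by
  refine ⟨fun X Y _ _ _ _ f hf g => ?_⟩
  let _ := Module.compHom X (algebraMap R A)
  let _ := Module.compHom Y (algebraMap R A)
  have : IsScalarTower R A X := ⟨fun r a x => by rw [Algebra.smul_def, mul_smul]; rfl⟩
  have : IsScalarTower R A Y := ⟨fun r a x => by rw [Algebra.smul_def, mul_smul]; rfl⟩
  obtain ⟨h, hh⟩ := hE.out (f.restrictScalars R) hf (t ∘ₗ g.restrictScalars R)
  obtain ⟨k, hk⟩ := (ht.bijective Y).2 h
  refine ⟨k, LinearMap.congr_fun (f := k ∘ₗ f) ((ht.bijective X).1 (LinearMap.ext fun x => ?_))⟩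
  exact (LinearMap.congr_fun hk (f x)).trans (hh x)

theorem IsTrace.cogenerator (ht : IsTrace A t) (hE : IsMatlisModule R E)
    (M : Type u) [AddCommGroup M] [Module A M] (m : M) (hm : m ≠ 0) :
    ∃ f : M →ₗ[A] W, f m ≠ 0 := by
  let _ := Module.compHom M (algebraMap R A)
  have : IsScalarTower R A M := ⟨fun r a x => by rw [Algebra.smul_def, mul_smul]; rfl⟩
  obtain ⟨φ, hφ⟩ := hE.cogenerator M m hm
  obtain ⟨f, rfl⟩ := (ht.bijective M).2 φ
  exact ⟨f, fun h => hφ (by simp [h])⟩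

theorem IsTrace.length_hom_le [IsArtinianRing R] (ht : IsTrace A t) (hE : IsMatlisModule R E)
    (M : Type u) [AddCommGroup M] [Module A M] [Module R M] [IsScalarTower R A M]
    [Module.Finite R M] : Module.length R (M →ₗ[A] W) ≤ Module.length R M := by
  rw [(ht.equiv M).length_eq]
  exact hE.length_hom_le (isFiniteLength_iff_isNoetherian_isArtinian.2 ⟨inferInstance, inferInstance⟩)

theorem IsTrace.finite_hom [IsArtinianRing R] (ht : IsTrace A t) (hE : IsMatlisModule R E)
    (M : Type u) [AddCommGroup M] [Module A M] [Module R M] [IsScalarTower R A M]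
    [Module.Finite R M] : Module.Finite R (M →ₗ[A] W) := by
  have h := (ht.length_hom_le hE M).trans_lt (Module.length_ne_top (R := R) (M := M)).lt_top
  have := (isFiniteLength_iff_isNoetherian_isArtinian.1 (Module.length_ne_top_iff.1 h.ne)).1
  infer_instance

theorem IsTrace.isHalfDuality [IsArtinianRing R] [Module.Finite R A] {B : Type u} [Ring B]
    [Algebra R B] [Module B W] [IsScalarTower R B W] [SMulCommClass A B W] [SMulCommClass B A W]
    (hE : IsMatlisModule R E) (ht : IsTrace A t) (ht' : IsTrace B t) : IsHalfDuality A B W where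
  injective := ht.injective hE.injective
  cogenerator := ht.cogenerator hE
  finite M _ _ _ := by
    let _ := Module.compHom M (algebraMap R A)
    have : IsScalarTower R A M := ⟨fun r a x => by rw [Algebra.smul_def, mul_smul]; rfl⟩
    have : Module.Finite R M := Module.Finite.trans A M
    have := ht.finite_hom hE M
    exact Module.Finite.of_restrictScalars_finite R B _
  reflexive M _ _ _ := by
    let _ := Module.compHom M (algebraMap R A)
    have : IsScalarTower R A M := ⟨fun r a x => by rw [Algebra.smul_def, mul_smul]; rfl⟩
    have : Module.Finite R M := Module.Finite.trans A M
    have := ht.finite_hom hE M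
    have := ht'.finite_hom hE (M →ₗ[A] W)
    -- The bidual is no longer than M, so the injective evaluation map must be onto.
    have hle := (ht'.length_hom_le hE (M →ₗ[A] W)).trans (ht.length_hom_le hE M)
    let ev : M →ₗ[R] ((M →ₗ[A] W) →ₗ[B] W) :=
      { toFun := fun m =>
          { toFun := fun f => f m
            map_add' := fun _ _ => rfl
            map_smul' := fun _ _ => rfl }
        map_add' := fun x y => by ext; simp
        map_smul' := fun r x => by
          ext f
          exact (f.restrictScalars R).map_smul r x }
    have hev : Function.Injective ev := by
      rw [injective_iff_map_eq_zero]
      intro x hx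
      by_contra h
      obtain ⟨f, hf⟩ := ht.cogenerator hE M x h
      exact hf (LinearMap.congr_fun hx f)
    have hsurj : LinearMap.range ev = ⊤ := by
      by_contra h
      have := Submodule.length_lt h
      rw [← (LinearEquiv.ofInjective ev hev).length_eq] at this
      exact this.not_ge hle
    intro φ
    obtain ⟨m, rfl⟩ := LinearMap.range_eq_top.1 hsurj φ
    exact ⟨m, fun f => rfl⟩

end

/-- An Artin algebra admits a duality between its finitely generated left modules and those of the
opposite algebra. -/
theorem exists_isHalfDuality {R : Type u} [CommRing R] [IsArtinianRing R] (A : Type u) [Ring A]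
    [Algebra R A] [Module.Finite R A] :
    ∃ (W : Type u) (_ : AddCommGroup W) (_ : Module A W) (_ : Module Aᵐᵒᵖ W)
      (_ : SMulCommClass A Aᵐᵒᵖ W) (_ : SMulCommClass Aᵐᵒᵖ A W),
      IsHalfDuality A Aᵐᵒᵖ W ∧ IsHalfDuality Aᵐᵒᵖ A W := by
  obtain ⟨E, _, _, hE⟩ := exists_isMatlisModule R
  let mA : Module A (A →ₗ[R] E) :=
    { smul := fun a w => w ∘ₗ LinearMap.mulRight R a
      one_smul := fun w => LinearMap.ext fun x => congrArg w (mul_one x)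
      mul_smul := fun a b w => LinearMap.ext fun x => congrArg w (mul_assoc x a b).symm
      smul_zero := fun a => rfl
      smul_add := fun a v w => rfl
      add_smul := fun a b w => LinearMap.ext fun x =>
        (congrArg w (mul_add x a b)).trans (map_add w _ _)
      zero_smul := fun w => LinearMap.ext fun x => (congrArg w (mul_zero x)).trans (map_zero w) }
  let mB : Module Aᵐᵒᵖ (A →ₗ[R] E) :=
    { smul := fun b w => w ∘ₗ LinearMap.mulLeft R b.unop
      one_smul := fun w => LinearMap.ext fun x => congrArg w (one_mul x)
      mul_smul := fun a b w => LinearMap.ext fun x => congrArg w (mul_assoc b.unop a.unop x)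
      smul_zero := fun a => rfl
      smul_add := fun a v w => rfl
      add_smul := fun a b w => LinearMap.ext fun x =>
        (congrArg w (add_mul a.unop b.unop x)).trans (map_add w _ _)
      zero_smul := fun w => LinearMap.ext fun x => (congrArg w (zero_mul x)).trans (map_zero w) }
  have hA : ∀ (a : A) (w : A →ₗ[R] E) (x : A), (a • w) x = w (x * a) := fun _ _ _ => rfl
  have hB : ∀ (b : Aᵐᵒᵖ) (w : A →ₗ[R] E) (x : A), (b • w) x = w (b.unop * x) := fun _ _ _ => rfl
  have _c1 : SMulCommClass A Aᵐᵒᵖ (A →ₗ[R] E) := ⟨fun a b w => LinearMap.ext fun x => by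
    rw [hA, hB, hB, hA, mul_assoc]⟩
  have _c2 := SMulCommClass.symm A Aᵐᵒᵖ (A →ₗ[R] E)
  have _s1 : IsScalarTower R A (A →ₗ[R] E) := ⟨fun r a w => LinearMap.ext fun x => by
    rw [hA, LinearMap.smul_apply, hA, mul_smul_comm, map_smul]⟩
  have _s2 : IsScalarTower R Aᵐᵒᵖ (A →ₗ[R] E) := ⟨fun r a w => LinearMap.ext fun x => by
    rw [hB, LinearMap.smul_apply, hB, MulOpposite.unop_smul, smul_mul_assoc, map_smul]⟩
  have : Module.Finite R Aᵐᵒᵖ := Module.Finite.equiv (MulOpposite.opLinearEquiv R)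
  -- Evaluation at 1 is a trace for both actions, so the two half dualities follow from one lemma.
  let t : (A →ₗ[R] E) →ₗ[R] E := LinearMap.applyₗ 1
  have ht : ∀ w, t w = w 1 := fun _ => rfl
  have h1 : IsTrace A t := by
    refine ⟨fun w w' h => LinearMap.ext fun a => ?_, fun φ => ⟨φ, fun a => ?_⟩⟩
    · have := h a
      rwa [ht, ht, hA, hA, one_mul] at this
    · rw [ht, hA, one_mul]
  have h2 : IsTrace Aᵐᵒᵖ t := by
    refine ⟨fun w w' h => LinearMap.ext fun a => ?_,
      fun φ => ⟨φ ∘ₗ (MulOpposite.opLinearEquiv R).toLinearMap, fun a => ?_⟩⟩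
    · have := h (MulOpposite.op a)
      rwa [ht, ht, hB, hB, mul_one] at this
    · rw [ht, hB, mul_one]; rfl
  exact ⟨A →ₗ[R] E, inferInstance, mA, mB, _c1, _c2, h1.isHalfDuality hE h2, h2.isHalfDuality hE h1⟩

/-! ### Projectives, injectives and finiteness under the duality -/

section

set_option linter.unusedSectionVars false

variable {A B W : Type u} [Ring A] [Ring B] [AddCommGroup W] [Module A W] [Module B W]
  [SMulCommClass A B W] [SMulCommClass B A W]

theorem IsHalfDuality.lcomp_surjective (h : IsHalfDuality A B W) {X Y : Type u} [AddCommGroup X]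
    [AddCommGroup Y] [Module A X] [Module A Y] {f : X →ₗ[A] Y} (hf : Function.Injective f) :
    Function.Surjective (LinearMap.lcomp B W f) := by
  intro g
  obtain ⟨k, hk⟩ := h.injective.out f hf g
  exact ⟨k, LinearMap.ext hk⟩

/-- Swapping arguments turns an extension problem into Hom(P, W) into a lifting problem out of P. -/
theorem IsHalfDuality.injective_hom (h : IsHalfDuality B A W) (P : Type u) [AddCommGroup P]
    [Module A P] [Module.Projective A P] : Module.Injective B (P →ₗ[A] W) := by
  refine ⟨fun X Y _ _ _ _ f hf g => ?_⟩
  obtain ⟨k, hk⟩ := Module.projective_lifting_property (LinearMap.lcomp A W f) g.flip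
    (h.lcomp_surjective hf)
  refine ⟨k.flip, fun x => LinearMap.ext fun p => ?_⟩
  exact LinearMap.congr_fun (LinearMap.congr_fun hk p) x

theorem IsHalfDuality.flip_injective (h : IsHalfDuality A B W) {M N : Type u} [AddCommGroup M]
    [Module A M] [AddCommGroup N] [Module B N] {f : N →ₗ[B] (M →ₗ[A] W)}
    (hf : Function.Surjective f) : Function.Injective f.flip := by
  rw [injective_iff_map_eq_zero]
  intro x hx
  by_contra hx0
  obtain ⟨g, hg⟩ := h.cogenerator M x hx0
  obtain ⟨y, rfl⟩ := hf g
  exact hg (LinearMap.congr_fun hx y)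

theorem IsHalfDuality.eq_of_forall_apply_eq (h : IsHalfDuality A B W) {M : Type u} [AddCommGroup M]
    [Module A M] {x y : M} (hxy : ∀ f : M →ₗ[A] W, f x = f y) : x = y := by
  by_contra hne
  obtain ⟨f, hf⟩ := h.cogenerator M (x - y) (sub_ne_zero.2 hne)
  exact hf (by rw [map_sub, hxy, sub_self])

/-- A free cover of the dual of J flips to an embedding of J, which splits since J is injective.
Dualizing the splitting splits the cover. -/
theorem IsHalfDuality.projective_hom (h : IsHalfDuality A B W) (h' : IsHalfDuality B A W)
    (J : Type u) [AddCommGroup J] [Module B J] [Module.Finite B J] [hJ : Module.Injective B J] :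
    Module.Projective A (J →ₗ[B] W) := by
  have := h'.finite J
  obtain ⟨k, f, hf⟩ := Module.Finite.exists_fin' A (J →ₗ[B] W)
  obtain ⟨r, hr⟩ := hJ.out f.flip (h'.flip_injective hf) LinearMap.id
  -- Reflexivity of the free module represents ψ ∘ r by an element, which defines the section; its
  -- linearity is tested against functionals.
  choose s hs using fun ψ : J →ₗ[B] W => h.reflexive (Fin k → A) (ψ ∘ₗ r)
  refine Module.Projective.of_split (P := J →ₗ[B] W) (M := Fin k → A)
    ⟨⟨s, fun x y => h.eq_of_forall_apply_eq fun g => ?_⟩,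
      fun a x => h.eq_of_forall_apply_eq fun g => ?_⟩ f ?_
  · rw [map_add, ← hs, ← hs, ← hs]; rfl
  · rw [map_smul, ← hs, ← hs]; rfl
  · ext ψ j
    refine (hs ψ (f.flip j)).symm.trans ?_
    exact congrArg ψ (hr j)

/-- Dualize a finite free cover of the dual module. -/
theorem IsHalfDuality.exists_injective_embedding (h : IsHalfDuality A B W)
    (h' : IsHalfDuality B A W) (M : Type u) [AddCommGroup M] [Module A M] [Module.Finite A M] :
    ∃ (J : Type u) (_ : AddCommGroup J) (_ : Module A J) (j : M →ₗ[A] J),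
      Module.Finite A J ∧ Module.Injective A J ∧ Function.Injective j := by
  have := h.finite M
  obtain ⟨k, f, hf⟩ := Module.Finite.exists_fin' B (M →ₗ[A] W)
  exact ⟨(Fin k → B) →ₗ[B] W, inferInstance, inferInstance, f.flip, h'.finite _,
    h.injective_hom _, h.flip_injective hf⟩

/-- Finitely generated modules are reflexive. -/
noncomputable def IsHalfDuality.evalEquiv (h : IsHalfDuality A B W) (M : Type u) [AddCommGroup M]
    [Module A M] [Module.Finite A M] : M ≃ₗ[A] ((M →ₗ[A] W) →ₗ[B] W) :=
  LinearEquiv.ofBijective (LinearMap.flip (LinearMap.id : (M →ₗ[A] W) →ₗ[B] (M →ₗ[A] W)))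
    ⟨h.flip_injective Function.surjective_id, fun φ => by
      obtain ⟨m, hm⟩ := h.reflexive M φ
      exact ⟨m, LinearMap.ext fun f => (hm f).symm⟩⟩

theorem IsInjectiveEnvelope.injective_of_comp {A : Type u} [Ring A] {M E : ModuleCat.{u} A}
    {f : M ⟶ E} (hf : IsInjectiveEnvelope f) {N : Type u} [AddCommGroup N] [Module A N]
    {g : E →ₗ[A] N} (hg : Function.Injective (g ∘ₗ f.hom)) : Function.Injective g := by
  rw [← LinearMap.ker_eq_bot]
  refine hf.essential _ (eq_bot_iff.2 ?_)
  rintro _ ⟨hx, x, rfl⟩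
  have : x = 0 := hg (by rw [map_zero]; exact hx)
  rw [this, map_zero]
  exact zero_mem _

theorem IsHalfDuality.finite_of_isInjectiveEnvelope [IsNoetherianRing A] (h : IsHalfDuality A B W)
    (h' : IsHalfDuality B A W) {M E : ModuleCat.{u} A} [Module.Finite A M] {f : M ⟶ E}
    (hf : IsInjectiveEnvelope f) : Module.Finite A E := by
  obtain ⟨J, _, _, j, _, hJ, hj⟩ := h.exists_injective_embedding h' M
  obtain ⟨g, hg⟩ := hJ.out f.hom ((ModuleCat.mono_iff_injective _).1 hf.mono) j
  refine Module.Finite.of_injective g (hf.injective_of_comp ?_)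
  rwa [show g ∘ₗ f.hom = j from LinearMap.ext hg]

theorem IsHalfDuality.finite_cosyzygy [IsNoetherianRing A] (h : IsHalfDuality A B W)
    (h' : IsHalfDuality B A W) (M : ModuleCat.{u} A) [Module.Finite A M] (i : ℕ) :
    Module.Finite A (cosyzygy M i) := by
  induction i with
  | zero => assumption
  | succ i ih =>
    have := h.finite_of_isInjectiveEnvelope h' (isInjectiveEnvelope_envelopeι (cosyzygy M i))
    exact Module.Finite.of_surjective
      (LinearMap.range (envelopeι (cosyzygy M i)).hom).mkQ (Submodule.mkQ_surjective _)

theorem IsHalfDuality.finite_minInj [IsNoetherianRing A] (h : IsHalfDuality A B W)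
    (h' : IsHalfDuality B A W) (M : ModuleCat.{u} A) [Module.Finite A M] (i : ℕ) :
    Module.Finite A (minInj M i) :=
  have := h.finite_cosyzygy h' M i
  h.finite_of_isInjectiveEnvelope h' (isInjectiveEnvelope_envelopeι (cosyzygy M i))

end

/-! ### Short exact sequences -/

section

variable {A : Type u} [Ring A]

/-- `0 → X → Y → Z → 0` is a short exact sequence of modules. -/
structure IsShortExact {X Y Z : Type u} [AddCommGroup X] [AddCommGroup Y] [AddCommGroup Z]
    [Module A X] [Module A Y] [Module A Z] (f : X →ₗ[A] Y) (g : Y →ₗ[A] Z) : Prop where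
  injective : Function.Injective f
  surjective : Function.Surjective g
  exact : Function.Exact f g

variable {X Y Z : Type u} [AddCommGroup X] [AddCommGroup Y] [AddCommGroup Z]
    [Module A X] [Module A Y] [Module A Z] {f : X →ₗ[A] Y} {g : Y →ₗ[A] Z}

theorem IsShortExact.shortExact (h : IsShortExact f g) :
    (ModuleCat.shortComplexOfCompEqZero f g h.exact.linearMap_comp_eq_zero).ShortExact :=
  ModuleCat.shortComplex_shortExact _ h.exact h.injective h.surjective

theorem isShortExact_subtype_ker (hg : Function.Surjective g) :
    IsShortExact (LinearMap.ker g).subtype g :=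
  ⟨Submodule.subtype_injective _, hg, LinearMap.exact_subtype_ker_map g⟩

theorem isShortExact_mkQ_range (hf : Function.Injective f) :
    IsShortExact f (LinearMap.range f).mkQ :=
  ⟨hf, Submodule.mkQ_surjective _, LinearMap.exact_map_mkQ_range f⟩

theorem IsShortExact.desc (h : IsShortExact f g) {T : Type u} [AddCommGroup T] [Module A T]
    (k : Y →ₗ[A] T) (hk : ∀ x, k (f x) = 0) : ∃ l : Z →ₗ[A] T, ∀ y, l (g y) = k y := by
  have h1 : LinearMap.ker g ≤ LinearMap.ker k := by
    intro y hy
    obtain ⟨x, rfl⟩ := (h.exact y).1 hy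
    exact hk x
  refine ⟨(LinearMap.ker g).liftQ k h1 ∘ₗ (g.quotKerEquivOfSurjective h.surjective).symm, fun y => ?_⟩
  have : (g.quotKerEquivOfSurjective h.surjective).symm (g y) = (LinearMap.ker g).mkQ y := by
    rw [LinearEquiv.symm_apply_eq]; rfl
  rw [LinearMap.comp_apply, LinearEquiv.coe_coe, this]
  rfl

theorem IsShortExact.lcomp {B W : Type u} [Ring B] [AddCommGroup W] [Module A W] [Module B W]
    [SMulCommClass A B W] [SMulCommClass B A W] (hW : IsHalfDuality A B W) (h : IsShortExact f g) :
    IsShortExact (LinearMap.lcomp B W g) (LinearMap.lcomp B W f) := by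
  refine ⟨LinearMap.lcomp_injective_of_surjective g h.surjective, hW.lcomp_surjective h.injective,
    fun k => ⟨fun hk => ?_, ?_⟩⟩
  · obtain ⟨l, hl⟩ := h.desc k (LinearMap.congr_fun hk)
    exact ⟨l, LinearMap.ext hl⟩
  · rintro ⟨l, rfl⟩
    ext x
    simp [h.exact.apply_apply_eq_zero]

theorem IsShortExact.piMap (h : IsShortExact f g) (k : ℕ) :
    IsShortExact (f.compLeft (Fin k)) (g.compLeft (Fin k)) := by
  refine ⟨fun x y hxy => funext fun i => h.injective (congrFun hxy i), fun z => ?_, fun y => ?_⟩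
  · choose y hy using fun i => h.surjective (z i)
    exact ⟨y, funext hy⟩
  · constructor
    · intro hy
      choose x hx using fun i => (h.exact (y i)).1 (congrFun hy i)
      exact ⟨x, funext hx⟩
    · rintro ⟨x, rfl⟩
      exact funext fun i => h.exact.apply_apply_eq_zero (x i)

end

/-! ### Resolutions and coresolutions by projective-injective modules -/

section

variable {A : Type u} [Ring A]

/-- A finitely generated module which is both projective and injective. -/
structure IsProjInj (A : Type u) [Ring A] (E : Type u) [AddCommGroup E] [Module A E] : Prop where
  finite : Module.Finite A E
  projective : Module.Projective A E
  injective : Module.Injective A E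

/-- There is an exact sequence `0 → X → E⁰ → ⋯ → Eᵏ⁻¹` with all `Eⁱ` finitely generated and
projective-injective. -/
def HasProjInjCoresolution : ℕ → ModuleCat.{u} A → Prop
  | 0, _ => True
  | k + 1, X => ∃ (E C : ModuleCat.{u} A) (f : X →ₗ[A] E) (g : E →ₗ[A] C),
      IsShortExact f g ∧ IsProjInj A E ∧ HasProjInjCoresolution k C

/-- There is an exact sequence `Pₖ₋₁ → ⋯ → P₀ → X → 0` with all `Pᵢ` finitely generated and
projective-injective. -/
def HasProjInjResolution : ℕ → ModuleCat.{u} A → Prop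
  | 0, _ => True
  | k + 1, X => ∃ (P K : ModuleCat.{u} A) (f : K →ₗ[A] P) (g : P →ₗ[A] X),
      IsShortExact f g ∧ IsProjInj A P ∧ HasProjInjResolution k K

theorem HasProjInjCoresolution.of_le {k j : ℕ} {X : ModuleCat.{u} A}
    (h : HasProjInjCoresolution k X) (hjk : j ≤ k) : HasProjInjCoresolution j X := by
  induction j generalizing k X with
  | zero => trivial
  | succ j ih =>
    obtain _ | k := k
    · omega
    obtain ⟨E, C, f, g, hfg, hE, hC⟩ := h
    exact ⟨E, C, f, g, hfg, hE, ih hC (by omega)⟩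

theorem IsProjInj.pi {E : Type u} [AddCommGroup E] [Module A E] (h : IsProjInj A E) (k : ℕ) :
    IsProjInj A (Fin k → E) := by
  have := h.finite
  have := h.projective
  refine ⟨inferInstance, ?_, ?_⟩
  · exact Module.Projective.of_equiv (DirectSum.linearEquivFunOnFintype A (Fin k) fun _ => E)
  · refine ⟨fun X Y _ _ _ _ f hf g => ?_⟩
    choose l hl using fun i => h.injective.out f hf (LinearMap.proj i ∘ₗ g)
    exact ⟨LinearMap.pi l, fun x => funext fun i => hl i x⟩

theorem HasProjInjCoresolution.pi {k : ℕ} {X : ModuleCat.{u} A} (h : HasProjInjCoresolution k X)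
    (r : ℕ) : HasProjInjCoresolution k (ModuleCat.of A (Fin r → X)) := by
  induction k generalizing X with
  | zero => trivial
  | succ k ih =>
    obtain ⟨E, C, f, g, hfg, hE, hC⟩ := h
    exact ⟨ModuleCat.of A (Fin r → E), ModuleCat.of A (Fin r → C), _, _, hfg.piMap r, hE.pi r, ih hC⟩

/-- Dimension shifting through the projective terms embeds the group into Ext of degree i + m,
beyond the injective dimension of K. -/
theorem HasProjInjCoresolution.ext_eq_zero {i : ℕ} {C K : ModuleCat.{u} A}
    (hC : HasProjInjCoresolution i C) {m : ℕ} (hm : 1 ≤ m) (hK : HasInjectiveDimensionLT K (i + m))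
    (e : Abelian.Ext C K m) : e = 0 := by
  induction i generalizing C m with
  | zero => exact e.eq_zero_of_hasInjectiveDimensionLT (0 + m) (by omega)
  | succ i ih =>
    obtain ⟨E, C', f, g, hfg, hE, hC'⟩ := hC
    have hproj : Projective (ModuleCat.of A E) := (IsProjective.iff_projective _).1 hE.projective
    have h0 : hfg.shortExact.extClass.comp e rfl = 0 :=
      ih hC' (by omega) (by rwa [add_assoc] at hK) _
    obtain ⟨x, rfl⟩ := Abelian.Ext.contravariant_sequence_exact₁ hfg.shortExact K e rfl h0
    rw [x.eq_zero_of_hasProjectiveDimensionLT 1 hm, Abelian.Ext.comp_zero]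

theorem IsShortExact.exists_extension {X Y Z K : Type u} [AddCommGroup X] [AddCommGroup Y]
    [AddCommGroup Z] [AddCommGroup K] [Module A X] [Module A Y] [Module A Z] [Module A K]
    {f : X →ₗ[A] Y} {g : Y →ₗ[A] Z} (h : IsShortExact f g)
    (h0 : ∀ e : Abelian.Ext (ModuleCat.of A Z) (ModuleCat.of A K) 1, e = 0) (q : X →ₗ[A] K) :
    ∃ k : Y →ₗ[A] K, ∀ x, k (f x) = q x := by
  obtain ⟨φ, hφ⟩ := Abelian.Ext.contravariant_sequence_exact₁ h.shortExact (ModuleCat.of A K)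
    (Abelian.Ext.mk₀ (ModuleCat.ofHom q)) (add_zero 1) (h0 _)
  obtain ⟨φ, rfl⟩ := Abelian.Ext.homEquiv₀.symm.surjective φ
  rw [Abelian.Ext.homEquiv₀_symm_apply, Abelian.Ext.mk₀_comp_mk₀] at hφ
  have := Abelian.Ext.homEquiv₀.symm.injective hφ
  exact ⟨φ.hom, fun x => LinearMap.congr_fun (congrArg ModuleCat.Hom.hom this) x⟩

/-- Each step replaces a free cover of K by a projective-injective one. The kernel's injective
dimension may rise by one, which is why i + k is what stays bounded. -/
theorem hasProjInjResolution_of_hasInjectiveDimensionLT [IsNoetherianRing A] {n : ℕ}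
    (hA : HasProjInjCoresolution n (regular A)) {i k : ℕ} (hik : i + k ≤ n) (K : ModuleCat.{u} A)
    [Module.Finite A K] (hK : HasInjectiveDimensionLT K (i + 1)) : HasProjInjResolution k K := by
  induction k generalizing i K with
  | zero => trivial
  | succ k ih =>
    obtain ⟨r, q, hq⟩ := Module.Finite.exists_fin' A K
    -- The cokernel C keeps i terms of coresolution, exactly enough for Ext¹(C, K) = 0, so q extends
    -- along Aʳ → E.
    obtain ⟨E, C, f, g, hfg, hE, hC⟩ := (hA.pi r).of_le (show i + 1 ≤ n by omega)
    obtain ⟨p, hp⟩ := hfg.exists_extension (hC.ext_eq_zero le_rfl hK) q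
    have hps : Function.Surjective p := fun y => by
      obtain ⟨x, rfl⟩ := hq y
      exact ⟨f x, hp x⟩
    have hse := isShortExact_subtype_ker hps
    have := hE.finite
    have hEinj : Injective (ModuleCat.of A E) :=
      (Module.injective_iff_injective_object A E).1 hE.injective
    exact ⟨E, ModuleCat.of A (LinearMap.ker p), _, p, hse, hE, ih (i := i + 1) (by omega) _
      (hse.shortExact.hasInjectiveDimensionLT_X₁ (i + 1) hK
        (hasInjectiveDimensionLT_of_ge (ModuleCat.of A E) 1 (i + 1 + 1) (by omega)))⟩

/-! ### Minimality of the injective coresolution -/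

theorem cosyzygy_succ (M : ModuleCat.{u} A) (i : ℕ) :
    cosyzygy M (i + 1) = cosyzygy (cosyzygy M 1) i := by
  induction i with
  | zero => rfl
  | succ i ih =>
    change ModuleCat.of A (envelope (cosyzygy M (i + 1)) ⧸
      LinearMap.range (envelopeι (cosyzygy M (i + 1))).hom) = _
    rw [ih]
    rfl

theorem minInj_succ (M : ModuleCat.{u} A) (i : ℕ) :
    minInj M (i + 1) = minInj (cosyzygy M 1) i := by
  rw [minInj, cosyzygy_succ]; rfl

theorem injective_envelope (M : ModuleCat.{u} A) : Module.Injective A (envelope M) :=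
  (Module.injective_iff_injective_object A _).2 (isInjectiveEnvelope_envelopeι M).injective

theorem envelopeι_injective (M : ModuleCat.{u} A) : Function.Injective (envelopeι M).hom :=
  (ModuleCat.mono_iff_injective _).1 (isInjectiveEnvelope_envelopeι M).mono

/-- An endomorphism of an injective envelope of `M` which fixes `M` is bijective. -/
theorem bijective_of_comp_envelopeι {M : ModuleCat.{u} A} (φ : envelope M →ₗ[A] envelope M)
    (hφ : ∀ x, φ ((envelopeι M).hom x) = (envelopeι M).hom x) : Function.Bijective φ := by
  have hinj : Function.Injective φ := by
    apply (isInjectiveEnvelope_envelopeι M).injective_of_comp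
    rw [show φ ∘ₗ (envelopeι M).hom = (envelopeι M).hom from LinearMap.ext hφ]
    exact envelopeι_injective M
  refine ⟨hinj, ?_⟩
  obtain ⟨ψ, hψ⟩ := (injective_envelope M).out φ hinj LinearMap.id
  have hψinj : Function.Injective ψ := by
    apply (isInjectiveEnvelope_envelopeι M).injective_of_comp
    have : ψ ∘ₗ (envelopeι M).hom = (envelopeι M).hom := LinearMap.ext fun x => by
      conv_lhs => rw [LinearMap.comp_apply, ← hφ x, hψ]
      rfl
    rw [this]
    exact envelopeι_injective M
  exact fun y => ⟨ψ y, hψinj (hψ (ψ y))⟩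

/-- A retraction of modules induces one between an injective envelope and any embedding into an
injective module, and between the cokernels. -/
theorem exists_retraction_envelope {X : ModuleCat.{u} A} {Y E C : Type u} [AddCommGroup Y]
    [AddCommGroup E] [AddCommGroup C] [Module A Y] [Module A E] [Module A C]
    {f : Y →ₗ[A] E} {g : E →ₗ[A] C} (hfg : IsShortExact f g) (hE : Module.Injective A E)
    (s : X →ₗ[A] Y) (r : Y →ₗ[A] X) (hrs : ∀ x, r (s x) = x) :
    (∃ (u : envelope X →ₗ[A] E) (v : E →ₗ[A] envelope X), ∀ x, v (u x) = x) ∧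
      ∃ (u : cosyzygy X 1 →ₗ[A] C) (v : C →ₗ[A] cosyzygy X 1), ∀ x, v (u x) = x := by
  obtain ⟨u, hu⟩ := hE.out (envelopeι X).hom (envelopeι_injective X) (f ∘ₗ s)
  obtain ⟨v₀, hv₀⟩ := (injective_envelope X).out f hfg.injective ((envelopeι X).hom ∘ₗ r)
  have hfix : ∀ x, (v₀ ∘ₗ u) ((envelopeι X).hom x) = (envelopeι X).hom x := fun x => by
    rw [LinearMap.comp_apply, hu, LinearMap.comp_apply, hv₀, LinearMap.comp_apply, hrs]
  -- v₀ ∘ u is only an automorphism fixing X; composing v₀ with its inverse gives a true retraction,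
  -- still compatible with r.
  let φ := LinearEquiv.ofBijective _ (bijective_of_comp_envelopeι _ hfix)
  let v := φ.symm.toLinearMap ∘ₗ v₀
  have hv : ∀ y, v (f y) = (envelopeι X).hom (r y) := fun y => by
    change φ.symm (v₀ (f y)) = _
    rw [hv₀, LinearEquiv.symm_apply_eq]
    exact (hfix (r y)).symm
  have hvu : ∀ x, v (u x) = x := fun x => φ.symm_apply_apply x
  refine ⟨⟨u, v, hvu⟩, ?_⟩
  have hX := isShortExact_mkQ_range (envelopeι_injective X)
  obtain ⟨u', hu'⟩ := hX.desc (g ∘ₗ u) fun x => by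
    rw [LinearMap.comp_apply, hu]; exact hfg.exact.apply_apply_eq_zero _
  obtain ⟨v', hv'⟩ := hfg.desc ((LinearMap.range (envelopeι X).hom).mkQ ∘ₗ v) fun y => by
    rw [LinearMap.comp_apply, hv]; exact hX.exact.apply_apply_eq_zero _
  refine ⟨u', v', fun x => ?_⟩
  obtain ⟨x, rfl⟩ := hX.surjective x
  exact (congrArg v' (hu' x)).trans ((hv' (u x)).trans (congrArg _ (hvu x)))

/-- Stated for a retract X of Y because, even when X = Y, the minimal cosyzygy is only a retract of
the given cokernel. -/
theorem HasProjInjCoresolution.projective_minInj {k : ℕ} {Y : ModuleCat.{u} A}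
    (hY : HasProjInjCoresolution k Y) {X : ModuleCat.{u} A} (s : X →ₗ[A] Y) (r : Y →ₗ[A] X)
    (hrs : ∀ x, r (s x) = x) {i : ℕ} (hi : i < k) : Module.Projective A (minInj X i) := by
  induction k generalizing X Y i with
  | zero => omega
  | succ k ih =>
    obtain ⟨E, C, f, g, hfg, hE, hC⟩ := hY
    obtain ⟨⟨u, v, huv⟩, ⟨u', v', huv'⟩⟩ := exists_retraction_envelope hfg hE.injective s r hrs
    obtain _ | i := i
    · have := hE.projective
      exact Module.Projective.of_split u v (LinearMap.ext huv)
    · rw [minInj_succ]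
      exact ih hC u' v' huv' (by omega)

theorem hasProjInjCoresolution_of_projective_minInj {M : ModuleCat.{u} A} {n : ℕ}
    (hfin : ∀ i < n, Module.Finite A (minInj M i))
    (hproj : ∀ i < n, Module.Projective A (minInj M i)) : HasProjInjCoresolution n M := by
  suffices ∀ k i, i + k = n → HasProjInjCoresolution k (cosyzygy M i) from this n 0 (by omega)
  intro k
  induction k with
  | zero => intro _ _; trivial
  | succ k ih =>
    intro i hi
    exact ⟨minInj M i, cosyzygy M (i + 1), _, _, isShortExact_mkQ_range (envelopeι_injective _),
      ⟨hfin i (by omega), hproj i (by omega), injective_envelope _⟩, ih (i + 1) (by omega)⟩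

end

/-! ### Symmetry of the dominant dimension -/

section

variable {A B W : Type u} [Ring A] [Ring B] [AddCommGroup W] [Module A W] [Module B W]
  [SMulCommClass A B W] [SMulCommClass B A W]

theorem IsProjInj.dual (h : IsHalfDuality A B W) (h' : IsHalfDuality B A W) {E : Type u}
    [AddCommGroup E] [Module A E] (hE : IsProjInj A E) : IsProjInj B (E →ₗ[A] W) := by
  have := hE.finite
  have := hE.projective
  have := hE.injective
  exact ⟨h.finite E, h'.projective_hom h E, h'.injective_hom E⟩

theorem HasProjInjResolution.dual (h : IsHalfDuality A B W) (h' : IsHalfDuality B A W) {k : ℕ}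
    {X : ModuleCat.{u} A} (hX : HasProjInjResolution k X) :
    HasProjInjCoresolution k (ModuleCat.of B (X →ₗ[A] W)) := by
  induction k generalizing X with
  | zero => trivial
  | succ k ih =>
    obtain ⟨P, K, f, g, hfg, hP, hK⟩ := hX
    exact ⟨ModuleCat.of B (P →ₗ[A] W), ModuleCat.of B (K →ₗ[A] W), _, _, hfg.lcomp h,
      hP.dual h h', ih hK⟩

/-- If the first `n` terms of the minimal injective resolution of `A` are projective, then so are
those of the dual algebra `B`. -/
theorem projective_minInj_dual [IsNoetherianRing A] (h : IsHalfDuality A B W)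
    (h' : IsHalfDuality B A W) {n : ℕ}
    (hA : ∀ i < n, Module.Projective A (minInj (regular A) i)) :
    ∀ i < n, Module.Projective B (minInj (regular B) i) := by
  have hfin : Module.Finite A (B →ₗ[B] W) := h'.finite B
  have hinj : Injective (ModuleCat.of A (B →ₗ[B] W)) :=
    (Module.injective_iff_injective_object A _).1 (h.injective_hom B)
  -- The dual of B is injective, so the construction starts at i = 0 and reaches all n terms.
  have hres : HasProjInjResolution n (ModuleCat.of A (B →ₗ[B] W)) :=
    hasProjInjResolution_of_hasInjectiveDimensionLT (i := 0)
      (hasProjInjCoresolution_of_projective_minInj (fun i _ => h.finite_minInj h' _ i) hA)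
      (by omega) _ inferInstance
  let e := h'.evalEquiv B
  exact fun i hi => (hres.dual h h').projective_minInj (X := regular B) e.toLinearMap
    e.symm.toLinearMap e.symm_apply_apply hi

end

/-! ### Projective and injective dimension -/

section

variable {A : Type u} [Ring A]

/-- The syzygy inherits the vanishing by dimension shifting, so it is projective by induction. Then
Ext¹ from X to it vanishes and the free cover splits. -/
theorem projective_of_ext_eq_zero [IsNoetherianRing A] {d : ℕ} (X : ModuleCat.{u} A)
    [Module.Finite A X] (hX : HasProjectiveDimensionLT X (d + 1))
    (hext : ∀ P : ModuleCat.{u} A, Module.Finite A P → Module.Projective A P →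
      ∀ i, 1 ≤ i → i ≤ d → ∀ e : Abelian.Ext X P i, e = 0) : Module.Projective A X := by
  induction d generalizing X with
  | zero => exact (IsProjective.iff_projective _).2 (projective_iff_hasProjectiveDimensionLT_one.2 hX)
  | succ d ih =>
    obtain ⟨r, q, hq⟩ := Module.Finite.exists_fin' A X
    have hse := isShortExact_subtype_ker hq
    have hfree : Projective (ModuleCat.of A (Fin r → A)) :=
      (IsProjective.iff_projective _).1 inferInstance
    have hK : Module.Projective A (LinearMap.ker q) := by
      refine ih (ModuleCat.of A (LinearMap.ker q)) (hse.shortExact.hasProjectiveDimensionLT_X₁ (d + 1)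
        (hasProjectiveDimensionLT_of_ge (ModuleCat.of A (Fin r → A)) 1 (d + 1) (by omega)) hX)
        fun P hP hP' i hi hid e => ?_
      have h0 : hse.shortExact.extClass.comp e rfl = 0 :=
        hext P hP hP' (1 + i) (by omega) (by omega) _
      obtain ⟨x, rfl⟩ := Abelian.Ext.contravariant_sequence_exact₁ hse.shortExact P e rfl h0
      rw [x.eq_zero_of_hasProjectiveDimensionLT 1 hi, Abelian.Ext.comp_zero]
    obtain ⟨ρ, hρ⟩ := hse.exists_extension
      (hext (ModuleCat.of A (LinearMap.ker q)) (inferInstanceAs (Module.Finite A (LinearMap.ker q)))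
        hK 1 le_rfl (by omega)) LinearMap.id
    obtain ⟨s, hs⟩ := hse.desc (LinearMap.id - (LinearMap.ker q).subtype ∘ₗ ρ) fun x => by
      rw [LinearMap.sub_apply, LinearMap.comp_apply, hρ]; exact sub_self _
    refine Module.Projective.of_split s q (LinearMap.ext fun x => ?_)
    obtain ⟨y, rfl⟩ := hq x
    rw [LinearMap.comp_apply, hs, LinearMap.sub_apply, map_sub]
    exact (congrArg (q y - ·) (ρ y).2).trans (sub_zero _)

/-- Dual to `projective_of_ext_eq_zero`; `hA` supplies embeddings whose cokernels remain finitely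
generated. -/
theorem injective_of_ext_eq_zero
    (hA : ∀ (M : Type u) [AddCommGroup M] [Module A M] [Module.Finite A M],
      ∃ (J : Type u) (_ : AddCommGroup J) (_ : Module A J) (j : M →ₗ[A] J),
        Module.Finite A J ∧ Module.Injective A J ∧ Function.Injective j)
    {d : ℕ} (X : ModuleCat.{u} A) [Module.Finite A X] (hX : HasInjectiveDimensionLT X (d + 1))
    (hext : ∀ J : ModuleCat.{u} A, Module.Finite A J → Module.Injective A J →
      ∀ i, 1 ≤ i → i ≤ d → ∀ e : Abelian.Ext J X i, e = 0) : Module.Injective A X := by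
  induction d generalizing X with
  | zero =>
    exact (Module.injective_iff_injective_object A X).2
      (injective_iff_hasInjectiveDimensionLT_one.2 hX)
  | succ d ih =>
    obtain ⟨J, _, _, j, hJf, hJ, hj⟩ := hA X
    have hse := isShortExact_mkQ_range hj
    have hJ' : Injective (ModuleCat.of A J) := (Module.injective_iff_injective_object A J).1 hJ
    have hC : Module.Injective A (J ⧸ LinearMap.range j) := by
      refine ih (ModuleCat.of A (J ⧸ LinearMap.range j))
        (hse.shortExact.hasInjectiveDimensionLT_X₃ (d + 1)
          (hasInjectiveDimensionLT_of_ge (ModuleCat.of A J) 1 (d + 1) (by omega)) hX)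
        fun I hI hI' i hi hid e => ?_
      have h0 : e.comp hse.shortExact.extClass rfl = 0 :=
        hext I hI hI' (i + 1) (by omega) (by omega) _
      obtain ⟨x, rfl⟩ := Abelian.Ext.covariant_sequence_exact₃ I hse.shortExact e rfl h0
      rw [x.eq_zero_of_hasInjectiveDimensionLT 1 hi, Abelian.Ext.zero_comp]
    obtain ⟨ρ, hρ⟩ := hse.exists_extension
      (hext (ModuleCat.of A (J ⧸ LinearMap.range j))
        (inferInstanceAs (Module.Finite A (J ⧸ LinearMap.range j))) hC 1 le_rfl (by omega))
      LinearMap.id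
    refine ⟨fun Y Z _ _ _ _ f hf g => ?_⟩
    obtain ⟨k, hk⟩ := hJ.out f hf (j ∘ₗ g)
    exact ⟨ρ ∘ₗ k, fun x => by rw [LinearMap.comp_apply, hk]; exact hρ (g x)⟩

/-- The inclusion of the `i`-th cosyzygy of `M` into `Iⁱ(M)`. -/
noncomputable def cosyzygyι (M : ModuleCat.{u} A) (i : ℕ) : cosyzygy M i →ₗ[A] minInj M i :=
  (envelopeι (cosyzygy M i)).hom

/-- The projection of `Iⁱ(M)` onto the next cosyzygy of `M`. -/
noncomputable def cosyzygyπ (M : ModuleCat.{u} A) (i : ℕ) :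
    minInj M i →ₗ[A] cosyzygy M (i + 1) :=
  (LinearMap.range (envelopeι (cosyzygy M i)).hom).mkQ

theorem isShortExact_cosyzygy (M : ModuleCat.{u} A) (i : ℕ) :
    IsShortExact (cosyzygyι M i) (cosyzygyπ M i) :=
  isShortExact_mkQ_range (envelopeι_injective _)

/-- Going down from the n-th cosyzygy, each projective term lowers the bound by one: the i-th
cosyzygy has projective dimension at most i. For i = 1 this bounds the middle term I⁰. -/
theorem hasProjectiveDimensionLT_minInj_zero {n : ℕ} (hn : 1 ≤ n)
    (hA : ∀ M : ModuleCat.{u} A, HasProjectiveDimensionLT M (n + 1))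
    (hI : ∀ i, 1 ≤ i → i < n → Module.Projective A (minInj (regular A) i)) :
    HasProjectiveDimensionLT (minInj (regular A) 0) 2 := by
  have key : ∀ k i, i + k = n → 1 ≤ i →
      HasProjectiveDimensionLT (cosyzygy (regular A) i) (i + 1) := by
    intro k
    induction k with
    | zero => rintro i rfl _; exact hA _
    | succ k ih =>
      intro i hik hi
      have : Projective (minInj (regular A) i) :=
        (IsProjective.iff_projective _).1 (hI i hi (by omega))
      exact (isShortExact_cosyzygy (regular A) i).shortExact.hasProjectiveDimensionLT_X₁ (i + 1)
        (hasProjectiveDimensionLT_of_ge (minInj (regular A) i) 1 (i + 1) (by omega))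
        (ih (i + 1) (by omega) (by omega))
  have : Projective (regular A) := (IsProjective.iff_projective _).1 inferInstance
  exact (isShortExact_cosyzygy (regular A) 0).shortExact.hasProjectiveDimensionLT_X₂ 2
    (hasProjectiveDimensionLT_of_ge (regular A) 1 2 (by omega)) (key (n - 1) 1 (by omega) le_rfl)

theorem hasProjectiveDimensionLT_minInj_of_sumMinInj {m d : ℕ}
    (h : HasProjectiveDimensionLT (sumMinInj m A) d) {i : ℕ} (hi : 1 ≤ i) (him : i ≤ m) :
    HasProjectiveDimensionLT (minInj (regular A) i) d := by
  let j : Finset.Icc 1 m := ⟨i, Finset.mem_Icc.2 ⟨hi, him⟩⟩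
  let r : Retract (minInj (regular A) i) (sumMinInj m A) :=
    { i := ModuleCat.ofHom (DirectSum.lof A (Finset.Icc 1 m) (fun j => minInj (regular A) j) j)
      r := ModuleCat.ofHom
        (DirectSum.component A (Finset.Icc 1 m) (fun j => minInj (regular A) j) j)
      retract := ModuleCat.hom_ext (LinearMap.ext fun x =>
        DirectSum.component.lof_self A (M := fun j : Finset.Icc 1 m => minInj (regular A) j) j x) }
  exact r.hasProjectiveDimensionLT d

theorem hasProjectiveDimensionLT_sumMinInj {m d : ℕ}
    (h : ∀ i ≤ m, Module.Projective A (minInj (regular A) i)) :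
    HasProjectiveDimensionLT (sumMinInj m A) (d + 1) := by
  have (i : Finset.Icc 1 m) : Module.Projective A (minInj (regular A) i) :=
    h i (Finset.mem_Icc.1 i.2).2
  have : Projective (sumMinInj m A) := (IsProjective.iff_projective _).1
    (inferInstanceAs (Module.Projective A
      (DirectSum (Finset.Icc 1 m) fun i => minInj (regular A) i)))
  exact hasProjectiveDimensionLT_of_ge _ 1 _ (by omega)

end

/-! ### Injective dimension of dual modules -/

section

variable {A B W : Type u} [Ring A] [Ring B] [AddCommGroup W] [Module A W] [Module B W]
  [SMulCommClass A B W] [SMulCommClass B A W]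

theorem IsHalfDuality.hasInjectiveDimensionLT (h : IsHalfDuality A B W) (h' : IsHalfDuality B A W)
    {d : ℕ} (X : ModuleCat.{u} B) (hX : HasProjectiveDimensionLT X (d + 1)) :
    HasInjectiveDimensionLT (ModuleCat.of A (X →ₗ[B] W)) (d + 1) := by
  induction d generalizing X with
  | zero =>
    have : Module.Projective B X :=
      (IsProjective.iff_projective _).2 (projective_iff_hasProjectiveDimensionLT_one.2 hX)
    exact injective_iff_hasInjectiveDimensionLT_one.1
      ((Module.injective_iff_injective_object A _).1 (h.injective_hom X))
  | succ d ih =>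
    have hse := isShortExact_subtype_ker (Finsupp.linearCombination_id_surjective B X)
    have hfree : Projective (ModuleCat.of B (X →₀ B)) :=
      (IsProjective.iff_projective _).1 inferInstance
    have hinj : Injective (ModuleCat.of A ((X →₀ B) →ₗ[B] W)) :=
      (Module.injective_iff_injective_object A _).1 (h.injective_hom _)
    have hK := ih (ModuleCat.of B (LinearMap.ker (Finsupp.linearCombination B (id : X → X))))
      (hse.shortExact.hasProjectiveDimensionLT_X₁ (d + 1)
        (hasProjectiveDimensionLT_of_ge (ModuleCat.of B (X →₀ B)) 1 (d + 1) (by omega)) hX)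
    exact (hse.lcomp h').shortExact.hasInjectiveDimensionLT_X₁ (d + 1) hK
      (hasInjectiveDimensionLT_of_ge (ModuleCat.of A ((X →₀ B) →ₗ[B] W)) 1 (d + 1 + 1) (by omega))

/-- The dual of `hasProjectiveDimensionLT_minInj_zero`, run over A on the dualized resolution of B,
so only dimensions of A-modules are needed. -/
theorem IsHalfDuality.hasInjectiveDimensionLT_minInj_zero (h : IsHalfDuality A B W)
    (h' : IsHalfDuality B A W) {n : ℕ} (hn : 1 ≤ n)
    (hA : ∀ M : ModuleCat.{u} A, HasInjectiveDimensionLT M (n + 1))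
    (hI : ∀ i, 1 ≤ i → i < n → Module.Injective A (minInj (regular B) i →ₗ[B] W)) :
    HasInjectiveDimensionLT (ModuleCat.of A (minInj (regular B) 0 →ₗ[B] W)) 2 := by
  have key : ∀ k i, i + k = n → 1 ≤ i →
      HasInjectiveDimensionLT (ModuleCat.of A (cosyzygy (regular B) i →ₗ[B] W)) (i + 1) := by
    intro k
    induction k with
    | zero => rintro i rfl _; exact hA _
    | succ k ih =>
      intro i hik hi
      have : Injective (ModuleCat.of A (minInj (regular B) i →ₗ[B] W)) :=
        (Module.injective_iff_injective_object A _).1 (hI i hi (by omega))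
      exact ((isShortExact_cosyzygy (regular B) i).lcomp h').shortExact.hasInjectiveDimensionLT_X₃
        (i + 1) (hasInjectiveDimensionLT_of_ge
          (ModuleCat.of A (minInj (regular B) i →ₗ[B] W)) 1 (i + 1) (by omega))
        (ih (i + 1) (by omega) (by omega))
  have : Injective (ModuleCat.of A (regular B →ₗ[B] W)) :=
    (Module.injective_iff_injective_object A _).1 (h.injective_hom B)
  exact ((isShortExact_cosyzygy (regular B) 0).lcomp h').shortExact.hasInjectiveDimensionLT_X₂ 2
    (key (n - 1) 1 (by omega) le_rfl)
    (hasInjectiveDimensionLT_of_ge (ModuleCat.of A (regular B →ₗ[B] W)) 1 2 (by omega))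

theorem IsHalfDuality.projective_of_injective_hom (h : IsHalfDuality A B W)
    (h' : IsHalfDuality B A W) (X : Type u) [AddCommGroup X] [Module B X] [Module.Finite B X]
    (hX : Module.Injective A (X →ₗ[B] W)) : Module.Projective B X := by
  have := h'.finite X
  have := h'.projective_hom h (X →ₗ[B] W)
  exact Module.Projective.of_equiv (h'.evalEquiv X).symm

end

/-! ### Maximal orthogonal subcategories of algebras of finite global dimension -/

section

variable {A : Type u} [Ring A] {n : ℕ}

theorem hasProjectiveDimensionLT_of_glDim (hgl : glDim A ≤ (n : WithBot ℕ∞)) (M : ModuleCat.{u} A) :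
    HasProjectiveDimensionLT M (n + 1) :=
  (projectiveDimension_le_iff M n).1 ((le_iSup _ M).trans hgl)

/-- The Ext groups into M vanish because every first argument has projective dimension at most n. -/
theorem hasInjectiveDimensionLT_of_glDim (hgl : glDim A ≤ (n : WithBot ℕ∞)) (M : ModuleCat.{u} A) :
    HasInjectiveDimensionLT M (n + 1) :=
  HasInjectiveDimensionLT.mk fun _ hi X e =>
    have := hasProjectiveDimensionLT_of_glDim hgl X
    e.eq_zero_of_hasProjectiveDimensionLT (n + 1) hi

variable {m : ℕ} {𝒞 : ObjectProperty (ModuleCat.{u} A)}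

theorem IsMaximalOrthogonal.of_projective (h𝒞 : IsMaximalOrthogonal m 𝒞 (ModuleCat.isFG A))
    (P : ModuleCat.{u} A) (hf : Module.Finite A P) (hP : Module.Projective A P) : 𝒞 P := by
  rw [h𝒞.eq_left]
  have : Projective P := (IsProjective.iff_projective P).1 hP
  exact ⟨⟨hf, fun C _ i hi _ => HasProjectiveDimensionLT.subsingleton P 1 i hi C⟩, hf⟩

theorem IsMaximalOrthogonal.of_injective (h𝒞 : IsMaximalOrthogonal m 𝒞 (ModuleCat.isFG A))
    (J : ModuleCat.{u} A) (hf : Module.Finite A J) (hJ : Module.Injective A J) : 𝒞 J := by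
  rw [h𝒞.eq_right]
  have : Injective J := (Module.injective_iff_injective_object A J).1 hJ
  exact ⟨⟨hf, fun C _ i hi _ => HasInjectiveDimensionLT.subsingleton J 1 i hi C⟩, hf⟩

theorem IsMaximalOrthogonal.ext_eq_zero (h𝒞 : IsMaximalOrthogonal m 𝒞 (ModuleCat.isFG A))
    {X Y : ModuleCat.{u} A} (hX : 𝒞 X) (hY : 𝒞 Y) {i : ℕ} (hi : 1 ≤ i) (him : i ≤ m)
    (e : Abelian.Ext X Y i) : e = 0 := by
  rw [h𝒞.eq_left] at hX
  have := hX.1.2 Y hY i hi him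
  exact Subsingleton.elim _ _

end

/-! ### The equivalence and the passage to the centre -/

theorem finite_of_smul_assoc {R Z A : Type*} [CommRing R] [CommRing Z] [Ring A] [Algebra R A]
    [Algebra R Z] [Algebra Z A] [Module.Finite R A]
    (h : ∀ (r : R) (z : Z) (a : A), (r • z) • a = r • z • a) : Module.Finite Z A :=
  have : IsScalarTower R Z A := ⟨h⟩
  Module.Finite.of_restrictScalars_finite R Z A

theorem tfae_isAuslanderAlgebra {R : Type u} [CommRing R] [IsArtinianRing R]
    (A : Type u) [Ring A] [Algebra R A] [Module.Finite R A]
    {n : ℕ} (hn : 2 ≤ n) (hgl : glDim A ≤ (n : WithBot ℕ∞))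
    {𝒞 : ObjectProperty (ModuleCat.{u} A)}
    (h𝒞 : IsMaximalOrthogonal (n - 1) 𝒞 (ModuleCat.isFG A)) :
    List.TFAE [IsAuslanderAlgebra (n - 1) A,
      projectiveDimension (sumMinInj (n - 1) A) ≤ ((n - 1 : ℕ) : WithBot ℕ∞),
      projectiveDimension (sumMinInj (n - 1) Aᵐᵒᵖ) ≤ ((n - 1 : ℕ) : WithBot ℕ∞)] := by
  obtain ⟨W, _, _, _, _, _, h, h'⟩ := exists_isHalfDuality (R := R) A
  have : Module.Finite R Aᵐᵒᵖ := Module.Finite.equiv (MulOpposite.opLinearEquiv R)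
  have : IsNoetherianRing A := isNoetherian_of_tower R inferInstance
  have : IsNoetherianRing Aᵐᵒᵖ := isNoetherian_of_tower R inferInstance
  have hd : n - 1 + 1 = n := by omega
  rw [projectiveDimension_le_iff, projectiveDimension_le_iff, HasProjectiveDimensionLE,
    HasProjectiveDimensionLE]
  have hfin := h.finite_minInj h' (regular A)
  have hfin' := h'.finite_minInj h (regular Aᵐᵒᵖ)
  -- Both the injective Iⁱ and every finitely generated projective lie in 𝒞, so the relevant Ext
  -- groups vanish.
  have hproj : ∀ i, HasProjectiveDimensionLT (minInj (regular A) i) (n - 1 + 1) →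
      Module.Projective A (minInj (regular A) i) := fun i hi => by
    have := hfin i
    exact projective_of_ext_eq_zero _ hi fun P hP hP' j hj hjn => h𝒞.ext_eq_zero
      (h𝒞.of_injective _ (hfin i) (injective_envelope _)) (h𝒞.of_projective P hP hP') hj hjn
  have hinj : ∀ i, HasInjectiveDimensionLT
      (ModuleCat.of A (minInj (regular Aᵐᵒᵖ) i →ₗ[Aᵐᵒᵖ] W)) (n - 1 + 1) →
      Module.Injective A (minInj (regular Aᵐᵒᵖ) i →ₗ[Aᵐᵒᵖ] W) := fun i hi => by
    have := hfin' i
    have hJ : Module.Injective Aᵐᵒᵖ (minInj (regular Aᵐᵒᵖ) i) := injective_envelope _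
    have hDf := h'.finite (minInj (regular Aᵐᵒᵖ) i)
    exact injective_of_ext_eq_zero (h.exists_injective_embedding h') _ hi
      fun P hP hP' j hj hjn => h𝒞.ext_eq_zero (h𝒞.of_injective P hP hP')
        (h𝒞.of_projective _ hDf (h.projective_hom h' _)) hj hjn
  tfae_have 1 → 2 := fun h1 => hasProjectiveDimensionLT_sumMinInj fun i hi =>
    (IsProjective.iff_projective (minInj (regular A) i)).2 (h1.projective i hi)
  tfae_have 2 → 1 := fun h2 => by
    refine ⟨by rwa [hd], fun i hi => (IsProjective.iff_projective _).1 ?_⟩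
    obtain rfl | hi0 := Nat.eq_zero_or_pos i
    · refine hproj 0 ?_
      -- This gives dimension at most 1, and 1 ≤ n - 1 is where n ≥ 2 enters.
      have := hasProjectiveDimensionLT_minInj_zero (n := n) (by omega)
        (hasProjectiveDimensionLT_of_glDim hgl)
        fun i hi hin => hproj i (hasProjectiveDimensionLT_minInj_of_sumMinInj h2 hi (by omega))
      exact hasProjectiveDimensionLT_of_ge _ 2 _ (by omega)
    · exact hproj i (hasProjectiveDimensionLT_minInj_of_sumMinInj h2 hi0 hi)
  tfae_have 1 → 3 := fun h1 => hasProjectiveDimensionLT_sumMinInj fun i hi =>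
    projective_minInj_dual h h' (n := n) (fun j hj =>
      (IsProjective.iff_projective (minInj (regular A) j)).2 (h1.projective j (by omega))) i
      (by omega)
  tfae_have 3 → 1 := fun h3 => by
    have hI : ∀ i, 1 ≤ i → i < n →
        Module.Injective A (minInj (regular Aᵐᵒᵖ) i →ₗ[Aᵐᵒᵖ] W) := fun i hi hin =>
      hinj i (h.hasInjectiveDimensionLT h' _
        (hasProjectiveDimensionLT_minInj_of_sumMinInj h3 hi (by omega)))
    have hI0 := hinj 0 (by
      have := h.hasInjectiveDimensionLT_minInj_zero h' (by omega)
        (hasInjectiveDimensionLT_of_glDim hgl) hI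
      exact hasInjectiveDimensionLT_of_ge _ 2 _ (by omega))
    have hB : ∀ i < n, Module.Projective Aᵐᵒᵖ (minInj (regular Aᵐᵒᵖ) i) := fun i hi => by
      have := hfin' i
      refine h.projective_of_injective_hom h' _ ?_
      obtain rfl | hi0 := Nat.eq_zero_or_pos i
      · exact hI0
      · exact hI i hi0 hi
    exact ⟨by rwa [hd], fun i hi => (IsProjective.iff_projective _).1
      (projective_minInj_dual h' h hB i (by omega))⟩
  tfae_finish

end HigherAuslander

theorem proposition3p3 {R : Type*} [CommRing R] [IsArtinianRing R]
    (Λ : Type u) [Ring Λ] [Algebra R Λ] [Module.Finite R Λ]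
    (n : ℕ) (hn : 2 ≤ n) (hgl : HigherAuslander.glDim Λ = (n : WithBot ℕ∞))
    (hmax : ∃ 𝒞 : ObjectProperty (ModuleCat.{u} Λ),
      HigherAuslander.IsMaximalOrthogonal (n - 1) 𝒞 (ModuleCat.isFG Λ)) :
    List.TFAE [
      HigherAuslander.IsAuslanderAlgebra (n - 1) Λ,
      projectiveDimension (HigherAuslander.sumMinInj (n - 1) Λ) ≤ ((n - 1 : ℕ) : WithBot ℕ∞),
      projectiveDimension (HigherAuslander.sumMinInj (n - 1) Λᵐᵒᵖ) ≤
        ((n - 1 : ℕ) : WithBot ℕ∞)] := by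
  obtain ⟨𝒞, h𝒞⟩ := hmax
  -- The duality needs the base ring in the universe of Λ. The centre is in that universe, is
  -- Artinian as an R-submodule of Λ, and Λ is finite over it.
  let Z := Subalgebra.center R Λ
  let _ : Algebra Z Λ := Z.val.toRingHom.toAlgebra' fun c x => (Subalgebra.mem_center_iff.1 c.2 x).symm
  have : IsArtinian R Z := inferInstanceAs (IsArtinian R (Subalgebra.toSubmodule Z))
  have : IsArtinianRing Z := isArtinian_of_tower R inferInstance
  have := HigherAuslander.finite_of_smul_assoc (R := R) (Z := Z) (A := Λ)
    fun r c x => smul_mul_assoc r (c : Λ) x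
  exact HigherAuslander.tfae_isAuslanderAlgebra (R := Z) Λ hn hgl.le h𝒞
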